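/- Let $L_1,\dots,L_n,R:\mathbb{R}^d\to\mathbb{R}$ and integers $1\le q\le s\le n$. Put $$L_q(\theta)=\frac1q\sum_{j=1}^n\gamma_jL_{(j)}(\theta)+R(\theta),\qquad \gamma_j=\frac{\sum_{l=0}^{q-1}\binom{j-1}{l}\binom{n-j}{s-l-1}}{\binom ns},$$ where $L_{(1)}(\theta)\ge\dots\ge L_{(n)}(\theta)$ are the values $L_1(\theta),\dots,L_n(\theta)$ in decreasing order (ties broken by index). Ordered SGD started at a deterministic $\theta^0$ with deterministic step sizes $\eta_t$ does the following at each step $t=0,1,2,\dots$: it draws a uniformly random $s$-element set $S_t\subseteq\{1,\dots,n\}$ independent of the past, picks $Q_t\subseteq S_t$ with $|Q_t|=q$ maximizing $\sum_{i\in Q}L_i(\theta^t)$ over all $q$-element $Q\subseteq S_t$, takes a subgradient $\tilde g^t\in\partial L_{Q_t}(\theta^t)$ of $L_{Q_t}=\frac1q\sum_{i\in Q_t}L_i+R$, chosen without looking at the future draws, and sets $\theta^{t+1}=\theta^t-\eta_t\tilde g^t$. Here, for a $\rho$-weakly convex function $f$ (that is, $f+\frac\rho2\|\cdot\|^2$ is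 convex; convex functions are the case $\rho=0$), $\partial f(x)=\{g: f(y)\ge f(x)+\langle g,y-x\rangle-\frac\rho2\|y-x\|^2\ \text{for all } y\}$. Suppose that every $L_i$ is $G_1$-Lipschitz, that $R$ is $G_2$-Lipschitz, and that $L_q$ has a minimizer $\theta^*\in\mathbb{R}^d$. Let $T\ge0$, $\eta_t\ge0$ for $0\le t\le T$ and $\sum_{t=0}^T\eta_t>0$. (1) If all $L_i$ and $R$ are convex, then $$\min_{0\le t\le T}\mathbb{E}\big[L_q(\theta^t)-L_q(\theta^*)\big]\le\frac{2(G_1^2+G_2^2)\sum_{t=0}^T\eta_t^2+\|\theta^*-\theta^0\|^2}{2\sum_{t=0}^T\eta_t}.$$ (2) Let $\rho\ge0$. If every $L_i$ is $\rho$-weakly convex and $R$ is convex, let $\bar\theta^T=\theta^{\tau}$, where $\tau$ is a random index independent of $(\theta^0,\dots,\theta^T)$ with $\mathbb{P}(\tau=t)=\eta_t/\sum_{k=0}^T\eta_k$ for $0\le t\le T$. Then for every $\hat\rho>\rho$ the Moreau envelope $L_q^{1/\hat\rho}(\theta)=\min_\beta\{L_q(\beta)+\frac{\hat\rho}{2}\|\beta-\theta\|^2\}$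 is well defined (the minimum is attained) and differentiable, and $$\mathbb{E}\big[\|\nabla L_q^{1/\hat\rho}(\bar\theta^T)\|^2\big]\le\frac{\hat\rho}{\hat\rho-\rho}\cdot\frac{\big(L_q^{1/\hat\rho}(\theta^0)-L_q(\theta^*)\big)+\hat\rho\,(G_1^2+G_2^2)\sum_{t=0}^T\eta_t^2}{\sum_{t=0}^T\eta_t}.$$ -/

import Mathlib

open MeasureTheory ProbabilityTheory
open scoped NNReal

noncomputable section

namespace OrderedSGD

/-- The `q`-argmax of the numbers `a i`, `i ∈ S`: the set of all `q`-element subsets `Q` of `S`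
for which `∑ i ∈ Q, a i` is maximal. -/
def qArgmax {n : ℕ} (a : Fin n → ℝ) (S : Finset (Fin n)) (q : ℕ) : Set (Finset (Fin n)) :=
  {Q | Q ⊆ S ∧ Q.card = q ∧
    ∀ Q' : Finset (Fin n), Q' ⊆ S → Q'.card = q → ∑ i ∈ Q', a i ≤ ∑ i ∈ Q, a i}

/-- The permutation `((1), …, (n))` that lists the numbers `a i` in decreasing order; ties are
broken by the original index (`Tuple.sort` is a stable sort). -/
def orderIndex {n : ℕ} (a : Fin n → ℝ) : Equiv.Perm (Fin n) :=
  Tuple.sort (fun i => -a i)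

/-- The weight `γ_j`, for `1 ≤ j ≤ n`. -/
def gammaWeight (n s q j : ℕ) : ℝ :=
  (∑ l ∈ Finset.range q, ((j - 1).choose l : ℝ) * ((n - j).choose (s - l - 1) : ℝ)) /
    (n.choose s : ℝ)

/-- The ordered empirical loss
`L_q(θ) = (1/q) ∑_{j=1}^n γ_j L_{(j)}(θ) + R(θ)`; the `0`-based index `j : Fin n` stands for
the `1`-based index `j + 1`. -/
def orderedLoss {n d : ℕ} (L : Fin n → EuclideanSpace ℝ (Fin d) → ℝ)
    (R : EuclideanSpace ℝ (Fin d) → ℝ) (s q : ℕ) (θ : EuclideanSpace ℝ (Fin d)) : ℝ :=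
  1 / (q : ℝ) *
      ∑ j : Fin n, gammaWeight n s q ((j : ℕ) + 1) * L (orderIndex (fun i => L i θ) j) θ +
    R θ

/-- The loss `L_Q(θ) = (1/q) ∑_{i ∈ Q} L_i(θ) + R(θ)` of the top-`q` samples. -/
def subsetLoss {n d : ℕ} (L : Fin n → EuclideanSpace ℝ (Fin d) → ℝ)
    (R : EuclideanSpace ℝ (Fin d) → ℝ) (q : ℕ) (Q : Finset (Fin n))
    (θ : EuclideanSpace ℝ (Fin d)) : ℝ :=
  1 / (q : ℝ) * ∑ i ∈ Q, L i θ + R θ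

/-- `ρ`-weak convexity on the whole space. -/
def WeaklyConvex {d : ℕ} (ρ : ℝ) (f : EuclideanSpace ℝ (Fin d) → ℝ) : Prop :=
  ConvexOn ℝ Set.univ (fun θ => f θ + ρ / 2 * ‖θ‖ ^ 2)

/-- The set of subgradients at `x` of a `ρ`-weakly convex function `f`; for `ρ = 0` this is the
subdifferential of convex analysis. -/
def subdifferential {d : ℕ} (ρ : ℝ) (f : EuclideanSpace ℝ (Fin d) → ℝ)
    (x : EuclideanSpace ℝ (Fin d)) : Set (EuclideanSpace ℝ (Fin d)) :=
  {g | ∀ y, f x + inner ℝ g (y - x) - ρ / 2 * ‖y - x‖ ^ 2 ≤ f y}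

/-- The Moreau envelope `f^μ(θ) = min_β { f(β) + ‖β - θ‖² / (2 μ) }`. -/
def moreauEnvelope {d : ℕ} (f : EuclideanSpace ℝ (Fin d) → ℝ) (μ : ℝ)
    (θ : EuclideanSpace ℝ (Fin d)) : ℝ :=
  ⨅ β, (f β + 1 / (2 * μ) * ‖β - θ‖ ^ 2)

/-- `θ` is a run of ordered SGD from `θ₀` with step sizes `η`, mini-batches `S t`, top-`q`
sets `Q t` and stochastic subgradients `g t`. The `σ`-algebra `ℱ t` is the history before
step `t`. The subgradient may be any nonanticipating random element of the subdifferential,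
and ties in the choice of `Q t` may be broken in any way. -/
structure IsOrderedSGD {n d : ℕ} {Ω : Type*} [mΩ : MeasurableSpace Ω] (P : Measure Ω)
    (ℱ : Filtration ℕ mΩ) (ρ : ℝ) (L : Fin n → EuclideanSpace ℝ (Fin d) → ℝ)
    (R : EuclideanSpace ℝ (Fin d) → ℝ) (s q : ℕ) (η : ℕ → ℝ) (θ₀ : EuclideanSpace ℝ (Fin d))
    (S Q : ℕ → Ω → Finset (Fin n)) (g θ : ℕ → Ω → EuclideanSpace ℝ (Fin d)) : Prop where
  /-- The start is `θ₀`. -/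
  init : ∀ ω, θ 0 ω = θ₀
  /-- The mini-batch is known after step `t`. -/
  measurable_batch : ∀ t, Measurable[ℱ (t + 1), ⊤] (S t)
  /-- The mini-batch has `s` elements. -/
  card_batch : ∀ t ω, (S t ω).card = s
  /-- The mini-batch is uniform among the `s`-element subsets of the index set. -/
  uniform_batch : ∀ t, ∀ A : Finset (Fin n), A.card = s →
    P.real {ω | S t ω = A} = 1 / (n.choose s : ℝ)
  /-- The mini-batch is independent of the history. -/
  indep_batch : ∀ t, Indep (MeasurableSpace.comap (S t) ⊤) (ℱ t) P
  /-- `Q t` consists of top-`q` samples of the mini-batch at the current iterate. -/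
  top : ∀ t ω, Q t ω ∈ qArgmax (fun i => L i (θ t ω)) (S t ω) q
  /-- The stochastic subgradient is known after step `t`. -/
  measurable_subgradient : ∀ t, Measurable[ℱ (t + 1)] (g t)
  /-- It is a subgradient of the loss of the top-`q` samples. -/
  subgradient : ∀ t ω, g t ω ∈ subdifferential ρ (subsetLoss L R q (Q t ω)) (θ t ω)
  /-- The update of the parameter. -/
  update : ∀ t ω, θ (t + 1) ω = θ t ω - η t • g t ω

end OrderedSGD

end

/-! The number `γ_j` is the probability that the index of rank `j` is among the top `q` of a uniform
`s`-element set. Hence `L_q` is the mean over all `s`-element sets `A` of `topLoss A`, a maximum of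
the losses `L_Q` over `Q ⊆ A` (`orderedLoss_eq`). As `L_{Q_t}` touches `topLoss S_t` from below at
`θ^t`, a subgradient of the former obeys the subgradient inequality of the latter. Averaged over
`S_t`, ordered SGD is thus a stochastic subgradient method for `L_q`, with steps bounded by `G₁ +
G₂`.

Both rates come from telescoping one inequality (`sum_integral_descent`) for a potential `V` and a
reference map `y`. In the convex case `V = ‖· - θ*‖²` and `y = θ*`. In the weakly convex case `V` is
the Moreau envelope and `y` the proximal map; the envelope has gradient `ρ̂ (x - prox x)`, and
strong convexity of the proximal problem (`IsProx.growth`) bounds the decrease below by a multiple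
of its squared norm. -/

noncomputable section

namespace OrderedSGD

/-! ### Counting: the weights `γ_j` as probabilities. -/

/-- The number of elements of `B` below `j`. -/
def rankIn {n : ℕ} (B : Finset (Fin n)) (j : Fin n) : ℕ := (B.filter (· < j)).card

theorem rankIn_lt_rankIn {n : ℕ} {B : Finset (Fin n)} {i j : Fin n} (hi : i ∈ B) (hij : i < j) :
    rankIn B i < rankIn B j := by
  refine Finset.card_lt_card (Finset.ssubset_iff_of_subset ?_ |>.2 ⟨i, ?_, ?_⟩)
  · intro k hk
    simp only [Finset.mem_filter] at hk ⊢
    exact ⟨hk.1, hk.2.trans hij⟩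
  · simp [hi, hij]
  · simp

theorem rankIn_injOn {n : ℕ} (B : Finset (Fin n)) : Set.InjOn (rankIn B) B := by
  intro i hi j hj h
  rcases lt_trichotomy i j with hij | hij | hij
  · exact absurd h (rankIn_lt_rankIn hi hij).ne
  · exact hij
  · exact absurd h (rankIn_lt_rankIn hj hij).ne'

theorem rankIn_lt_card {n : ℕ} {B : Finset (Fin n)} {i : Fin n} (hi : i ∈ B) :
    rankIn B i < B.card := by
  refine Finset.card_lt_card (Finset.ssubset_iff_of_subset (Finset.filter_subset _ _) |>.2
    ⟨i, hi, by simp⟩)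

theorem image_rankIn {n : ℕ} (B : Finset (Fin n)) : B.image (rankIn B) = Finset.range B.card := by
  refine Finset.eq_of_subset_of_card_le ?_ ?_
  · intro r hr
    obtain ⟨i, hi, rfl⟩ := Finset.mem_image.1 hr
    exact Finset.mem_range.2 (rankIn_lt_card hi)
  · rw [Finset.card_image_of_injOn (rankIn_injOn B), Finset.card_range]

/-- The `q` smallest elements of `B`. -/
def initialPart {n : ℕ} (q : ℕ) (B : Finset (Fin n)) : Finset (Fin n) :=
  B.filter (fun j => rankIn B j < q)

theorem card_initialPart {n q : ℕ} {B : Finset (Fin n)} (hq : q ≤ B.card) :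
    (initialPart q B).card = q := by
  have h1 : ((initialPart q B).image (rankIn B)).card = (initialPart q B).card :=
    Finset.card_image_of_injOn ((rankIn_injOn B).mono (by
      intro x hx; exact (Finset.mem_filter.1 (Finset.mem_coe.1 hx)).1))
  have h2 : (initialPart q B).image (rankIn B) = Finset.range q := by
    ext r
    have h3 := Finset.ext_iff.1 (image_rankIn B) r
    simp only [initialPart, Finset.mem_image, Finset.mem_filter, Finset.mem_range] at h3 ⊢
    constructor
    · rintro ⟨a, ha, rfl⟩; exact ha.2
    · intro hr
      obtain ⟨a, ha, rfl⟩ := h3.2 (hr.trans_le hq)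
      exact ⟨a, ⟨ha, hr⟩, rfl⟩
  rw [← h1, h2, Finset.card_range]

/-- Exchange argument: `F \ Q` and `Q \ F` have equal size, and every element of the former precedes
every element of the latter. -/
theorem initialPart_mem_qArgmax {n q : ℕ} {b : Fin n → ℝ} (hb : Antitone b)
    {B : Finset (Fin n)} (hq : q ≤ B.card) : initialPart q B ∈ qArgmax b B q := by
  refine ⟨Finset.filter_subset _ _, card_initialPart hq, fun Q hQ hc => ?_⟩
  set F := initialPart q B with hF
  have hcard : (Q \ F).card = (F \ Q).card :=
    Finset.card_sdiff_comm (by rw [hc, hF, card_initialPart hq])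
  have hlt : ∀ i ∈ F \ Q, ∀ j ∈ Q \ F, b j ≤ b i := by
    intro i hi j hj
    refine hb (le_of_not_gt fun hji => ?_)
    simp only [hF, initialPart, Finset.mem_sdiff, Finset.mem_filter] at hi hj
    exact hj.2 ⟨hQ hj.1, (rankIn_lt_rankIn (hQ hj.1) hji).trans hi.1.2⟩
  have hsd : ∑ i ∈ Q \ F, b i ≤ ∑ i ∈ F \ Q, b i := by
    rcases (F \ Q).eq_empty_or_nonempty with h | h
    · have h' : Q \ F = ∅ := by rw [← Finset.card_eq_zero, hcard, h, Finset.card_empty]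
      rw [h, h']
    · obtain ⟨m, hm, hmin⟩ := Finset.exists_min_image (F \ Q) b h
      calc ∑ i ∈ Q \ F, b i ≤ (Q \ F).card • b m :=
            Finset.sum_le_card_nsmul _ _ _ fun j hj => hlt m hm j hj
        _ = (F \ Q).card • b m := by rw [hcard]
        _ ≤ ∑ i ∈ F \ Q, b i := Finset.card_nsmul_le_sum _ _ _ hmin
  have e1 := Finset.sum_inter_add_sum_sdiff Q F b
  have e2 := Finset.sum_inter_add_sum_sdiff F Q b
  rw [Finset.inter_comm] at e2
  linarith

/-- Such a `B` is cut at `j` into `l` of the `j` smaller indices and `s - l - 1` of the `n - (j +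
1)` larger ones; `j` is 0-based. -/
theorem card_filter_rankIn_eq {n s l : ℕ} (hl : l < s) (j : Fin n) :
    ((Finset.univ.powersetCard s).filter (fun B : Finset (Fin n) => j ∈ B ∧ rankIn B j = l)).card =
      (j : ℕ).choose l * (n - (j + 1)).choose (s - l - 1) := by
  have e : (j : ℕ).choose l * (n - (j + 1)).choose (s - l - 1) =
      (((Finset.Iio j).powersetCard l) ×ˢ ((Finset.Ioi j).powersetCard (s - l - 1))).card := by
    rw [Finset.card_product, Finset.card_powersetCard, Finset.card_powersetCard, Fin.card_Iio,
      Fin.card_Ioi]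
    congr 2
    omega
  have key : ∀ B : Finset (Fin n), j ∈ B →
      B.card = (B.filter (· < j)).card + (B.filter (j < ·)).card + 1 := by
    intro B hj
    have : B = insert j (B.filter (· < j) ∪ B.filter (j < ·)) := by
      ext k
      simp only [Finset.mem_insert, Finset.mem_union, Finset.mem_filter]
      constructor
      · intro hk
        rcases lt_trichotomy k j with h | h | h <;> simp [h, hk]
      · rintro (rfl | h | h)
        exacts [hj, h.1, h.1]
    conv_lhs => rw [this]
    rw [Finset.card_insert_of_notMem (by simp), Finset.card_union_of_disjoint]
    rw [Finset.disjoint_filter]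
    intro k _ h
    exact h.not_gt
  rw [e]
  refine Finset.card_nbij' (fun B => (B.filter (· < j), B.filter (j < ·)))
    (fun p => insert j (p.1 ∪ p.2)) ?_ ?_ ?_ ?_
  · intro B hB
    obtain ⟨hB1, hj, hr⟩ := Finset.mem_filter.1 (Finset.mem_coe.1 hB)
    have hc := (Finset.mem_powersetCard.1 hB1).2
    have := key B hj
    rw [rankIn] at hr
    simp only [Finset.coe_product, Set.mem_prod, Finset.mem_coe, Finset.mem_powersetCard]
    refine ⟨⟨fun k hk => ?_, hr⟩, ⟨fun k hk => ?_, by omega⟩⟩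
    · exact Finset.mem_Iio.2 (Finset.mem_filter.1 hk).2
    · exact Finset.mem_Ioi.2 (Finset.mem_filter.1 hk).2
  · rintro ⟨X, Y⟩ hp
    simp only [Finset.coe_product, Set.mem_prod, Finset.mem_coe, Finset.mem_powersetCard] at hp
    obtain ⟨⟨hX, hXc⟩, hY, hYc⟩ := hp
    have hX' : ∀ k ∈ X, k < j := fun k hk => Finset.mem_Iio.1 (hX hk)
    have hY' : ∀ k ∈ Y, j < k := fun k hk => Finset.mem_Ioi.1 (hY hk)
    have f1 : (insert j (X ∪ Y)).filter (· < j) = X := by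
      ext k
      simp only [Finset.mem_filter, Finset.mem_insert, Finset.mem_union]
      grind
    have f2 : (insert j (X ∪ Y)).filter (j < ·) = Y := by
      ext k
      simp only [Finset.mem_filter, Finset.mem_insert, Finset.mem_union]
      grind
    have := key (insert j (X ∪ Y)) (Finset.mem_insert_self _ _)
    rw [f1, f2] at this
    refine Finset.mem_coe.2 (Finset.mem_filter.2 ⟨Finset.mem_powersetCard.2
      ⟨Finset.subset_univ _, by change (insert j (X ∪ Y)).card = s; omega⟩, Finset.mem_insert_self _ _, ?_⟩)
    rw [rankIn, f1, hXc]
  · intro B hB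
    simp only [Finset.mem_coe, Finset.mem_filter] at hB
    ext k
    simp only [Finset.mem_insert, Finset.mem_union, Finset.mem_filter]
    grind
  · rintro ⟨X, Y⟩ hp
    simp only [Finset.coe_product, Set.mem_prod, Finset.mem_coe, Finset.mem_powersetCard] at hp
    obtain ⟨⟨hX, hXc⟩, hY, hYc⟩ := hp
    have hX' : ∀ k ∈ X, k < j := fun k hk => Finset.mem_Iio.1 (hX hk)
    have hY' : ∀ k ∈ Y, j < k := fun k hk => Finset.mem_Ioi.1 (hY hk)
    ext k <;> simp only [Finset.mem_filter, Finset.mem_insert, Finset.mem_union] <;> grind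

theorem card_filter_mem_initialPart {n s q : ℕ} (hqs : q ≤ s) (j : Fin n) :
    ((Finset.univ.powersetCard s).filter (fun B : Finset (Fin n) => j ∈ initialPart q B)).card =
      ∑ l ∈ Finset.range q, (j : ℕ).choose l * (n - (j + 1)).choose (s - l - 1) := by
  have : (Finset.univ.powersetCard s).filter (fun B : Finset (Fin n) => j ∈ initialPart q B) =
      (Finset.range q).biUnion (fun l => (Finset.univ.powersetCard s).filter
        (fun B : Finset (Fin n) => j ∈ B ∧ rankIn B j = l)) := by
    ext B
    simp only [initialPart, Finset.mem_filter, Finset.mem_biUnion, Finset.mem_range]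
    constructor
    · rintro ⟨h1, h2, h3⟩
      exact ⟨_, h3, h1, h2, rfl⟩
    · rintro ⟨l, h3, h1, h2, rfl⟩
      exact ⟨h1, h2, h3⟩
  rw [this, Finset.card_biUnion]
  · exact Finset.sum_congr rfl fun l hl =>
      card_filter_rankIn_eq ((Finset.mem_range.1 hl).trans_le hqs) j
  · intro l _ l' _ hll
    simp only [Function.onFun]
    refine Finset.disjoint_filter.2 fun B _ h h' => hll (h.2.symm.trans h'.2)

/-- Double counting: after exchanging the sums, the coefficient of `b j` is the number of sets whose
`q` smallest elements include `j`. -/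
theorem sum_initialPart {n s q : ℕ} (hqs : q ≤ s) (hsn : s ≤ n) (b : Fin n → ℝ) :
    ∑ B ∈ Finset.univ.powersetCard s, ∑ j ∈ initialPart q B, b j =
      n.choose s * ∑ j : Fin n, gammaWeight n s q ((j : ℕ) + 1) * b j := by
  have hC : (n.choose s : ℝ) ≠ 0 := by exact_mod_cast (Nat.choose_pos hsn).ne'
  have h1 : ∀ B : Finset (Fin n), ∑ j ∈ initialPart q B, b j =
      ∑ j : Fin n, if j ∈ initialPart q B then b j else 0 := by
    intro B
    simp
  simp_rw [h1]
  rw [Finset.sum_comm, Finset.mul_sum]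
  refine Finset.sum_congr rfl fun j _ => ?_
  rw [← Finset.sum_filter, Finset.sum_const, card_filter_mem_initialPart hqs, nsmul_eq_mul,
    gammaWeight, ← mul_assoc, mul_div_cancel₀ _ hC]
  push_cast
  simp

theorem qArgmax_map {n q : ℕ} (σ : Equiv.Perm (Fin n)) (a : Fin n → ℝ) (B F : Finset (Fin n))
    (h : F ∈ qArgmax (a ∘ σ) B q) :
    F.map σ.toEmbedding ∈ qArgmax a (B.map σ.toEmbedding) q := by
  obtain ⟨h1, h2, h3⟩ := h
  refine ⟨Finset.map_subset_map.2 h1, by rw [Finset.card_map, h2], fun Q hQ hc => ?_⟩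
  have := h3 (Q.map σ.symm.toEmbedding) (fun k hk => by
    obtain ⟨i, hi, rfl⟩ := Finset.mem_map.1 hk
    obtain ⟨i', hi', rfl⟩ := Finset.mem_map.1 (hQ hi)
    simpa using hi') (by rw [Finset.card_map, hc])
  simpa [Finset.sum_map] using this

theorem qArgmax_sum_eq {n q : ℕ} {a : Fin n → ℝ} {A F F' : Finset (Fin n)}
    (h : F ∈ qArgmax a A q) (h' : F' ∈ qArgmax a A q) : ∑ i ∈ F, a i = ∑ i ∈ F', a i :=
  le_antisymm (h'.2.2 F h.1 h.2.1) (h.2.2 F' h'.1 h'.2.1)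

theorem antitone_comp_orderIndex {n : ℕ} (a : Fin n → ℝ) : Antitone (a ∘ orderIndex a) := by
  intro i j hij
  have := Tuple.monotone_sort (fun i => -a i) hij
  simpa [orderIndex] using this

theorem qArgmax_nonempty {n q : ℕ} (a : Fin n → ℝ) {A : Finset (Fin n)} (hq : q ≤ A.card) :
    (qArgmax a A q).Nonempty := by
  obtain ⟨Q, hQ, h⟩ := Finset.exists_max_image (A.powersetCard q) (fun Q => ∑ i ∈ Q, a i)
    (Finset.powersetCard_nonempty.2 hq)
  rw [Finset.mem_powersetCard] at hQ
  exact ⟨Q, hQ.1, hQ.2, fun Q' h1 h2 => h Q' (Finset.mem_powersetCard.2 ⟨h1, h2⟩)⟩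

/-- The weighted sum of the ordered values is the mean over all mini-batches of the sum of the
`q` largest values of the mini-batch. -/
theorem sum_qArgmax {n s q : ℕ} (hqs : q ≤ s) (hsn : s ≤ n) (a : Fin n → ℝ)
    (F : Finset (Fin n) → Finset (Fin n))
    (hF : ∀ A : Finset (Fin n), A.card = s → F A ∈ qArgmax a A q) :
    ∑ A ∈ Finset.univ.powersetCard s, ∑ i ∈ F A, a i =
      n.choose s * ∑ j : Fin n, gammaWeight n s q ((j : ℕ) + 1) * a (orderIndex a j) := by
  set σ := orderIndex a
  have := sum_initialPart hqs hsn (a ∘ σ)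
  simp only [Function.comp_apply] at this
  rw [← this]
  -- The sorting permutation maps sets of ranks bijectively to sets of indices; in terms of ranks
  -- the values are antitone.
  refine (Finset.sum_nbij' (fun B => B.map σ.toEmbedding) (fun A => A.map σ.symm.toEmbedding)
    ?_ ?_ ?_ ?_ ?_).symm
  · intro B hB
    simpa [Finset.mem_powersetCard] using hB
  · intro B hB
    simpa [Finset.mem_powersetCard] using hB
  · intro B hB
    ext; simp
  · intro B hB
    ext; simp
  · intro B hB
    have hc : B.card = s := (Finset.mem_powersetCard.1 hB).2
    have h1 := qArgmax_map σ a B _ (initialPart_mem_qArgmax (antitone_comp_orderIndex a)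
      (hc.symm ▸ hqs))
    -- Ties are harmless: all maximizers give the same sum.
    rw [qArgmax_sum_eq (hF _ (by rw [Finset.card_map, hc])) h1, Finset.sum_map]
    rfl

/-! ### The ordered loss as a mean of maxima. -/

/-- The largest loss `subsetLoss L R q Q θ` over all `q`-element subsets `Q` of `A`. -/
def topLoss {n d : ℕ} (L : Fin n → EuclideanSpace ℝ (Fin d) → ℝ)
    (R : EuclideanSpace ℝ (Fin d) → ℝ) (q : ℕ) (A : Finset (Fin n))
    (θ : EuclideanSpace ℝ (Fin d)) : ℝ :=
  if h : (A.powersetCard q).Nonempty then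
    (A.powersetCard q).sup' h (fun Q => subsetLoss L R q Q θ) else 0

section Losses

variable {n d s q : ℕ} {L : Fin n → EuclideanSpace ℝ (Fin d) → ℝ}
  {R : EuclideanSpace ℝ (Fin d) → ℝ}

theorem subsetLoss_le_topLoss {A Q : Finset (Fin n)} (hQ : Q ⊆ A) (hc : Q.card = q)
    (θ : EuclideanSpace ℝ (Fin d)) : subsetLoss L R q Q θ ≤ topLoss L R q A θ := by
  have hm : Q ∈ A.powersetCard q := Finset.mem_powersetCard.2 ⟨hQ, hc⟩
  rw [topLoss, dif_pos ⟨Q, hm⟩]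
  exact Finset.le_sup' (fun Q => subsetLoss L R q Q θ) hm

theorem exists_topLoss_eq {A : Finset (Fin n)} (hq : q ≤ A.card)
    (θ : EuclideanSpace ℝ (Fin d)) :
    ∃ Q : Finset (Fin n), Q ⊆ A ∧ Q.card = q ∧ topLoss L R q A θ = subsetLoss L R q Q θ := by
  have h := Finset.powersetCard_nonempty.2 hq
  obtain ⟨Q, hQ, he⟩ := Finset.exists_mem_eq_sup' h (fun Q => subsetLoss L R q Q θ)
  rw [Finset.mem_powersetCard] at hQ
  exact ⟨Q, hQ.1, hQ.2, by rw [topLoss, dif_pos h, he]⟩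

theorem topLoss_eq_of_mem_qArgmax {A Q : Finset (Fin n)} {θ : EuclideanSpace ℝ (Fin d)}
    (h : Q ∈ qArgmax (fun i => L i θ) A q) : topLoss L R q A θ = subsetLoss L R q Q θ := by
  refine le_antisymm ?_ (subsetLoss_le_topLoss h.1 h.2.1 θ)
  obtain ⟨Q', h1, h2, h3⟩ := exists_topLoss_eq (L := L) (R := R)
    (h.2.1 ▸ Finset.card_le_card h.1 : q ≤ A.card) θ
  rw [h3, subsetLoss, subsetLoss]
  have := h.2.2 Q' h1 h2
  gcongr

theorem orderedLoss_eq (hqs : q ≤ s) (hsn : s ≤ n) (θ : EuclideanSpace ℝ (Fin d)) :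
    orderedLoss L R s q θ =
      1 / (n.choose s : ℝ) * ∑ A ∈ Finset.univ.powersetCard s, topLoss L R q A θ := by
  have hC : (n.choose s : ℝ) ≠ 0 := by exact_mod_cast (Nat.choose_pos hsn).ne'
  have hne : ∀ A : Finset (Fin n), ∃ F : Finset (Fin n), A.card = s →
      F ∈ qArgmax (fun i => L i θ) A q := by
    intro A
    by_cases hA : A.card = s
    · obtain ⟨F, hF⟩ := qArgmax_nonempty (fun i => L i θ) (hA.symm ▸ hqs : q ≤ A.card)
      exact ⟨F, fun _ => hF⟩
    · exact ⟨∅, fun h => absurd h hA⟩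
  choose F hF using hne
  have h1 : ∑ A ∈ Finset.univ.powersetCard s, topLoss L R q A θ =
      ∑ A ∈ Finset.univ.powersetCard s, (1 / (q : ℝ) * ∑ i ∈ F A, L i θ + R θ) :=
    Finset.sum_congr rfl fun A hA =>
      topLoss_eq_of_mem_qArgmax (hF A (Finset.mem_powersetCard.1 hA).2)
  rw [h1, Finset.sum_add_distrib, ← Finset.mul_sum, sum_qArgmax hqs hsn (fun i => L i θ) F hF,
    Finset.sum_const, Finset.card_powersetCard, Finset.card_univ, Fintype.card_fin, nsmul_eq_mul,
    orderedLoss]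
  field_simp

theorem continuous_topLoss (hL : ∀ i, Continuous (L i)) (hR : Continuous R)
    (A : Finset (Fin n)) : Continuous (topLoss L R q A) := by
  by_cases h : (A.powersetCard q).Nonempty
  · have : topLoss L R q A = fun θ =>
        (A.powersetCard q).sup' h (fun Q => subsetLoss L R q Q θ) := by
      ext θ; rw [topLoss, dif_pos h]
    rw [this]
    refine Continuous.finset_sup'_apply h fun Q _ => ?_
    unfold subsetLoss
    fun_prop
  · have : topLoss L R q A = fun _ => 0 := by
      ext θ; rw [topLoss, dif_neg h]
    rw [this]
    exact continuous_const

theorem continuous_orderedLoss (hqs : q ≤ s) (hsn : s ≤ n) (hL : ∀ i, Continuous (L i))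
    (hR : Continuous R) : Continuous (orderedLoss L R s q) := by
  rw [funext (orderedLoss_eq hqs hsn)]
  have := fun A => continuous_topLoss (q := q) hL hR A
  fun_prop

/-- The `q` Lipschitz bounds cancel the factor `1 / q`. This one-sided form is all that the bound on
subgradients needs. -/
theorem subsetLoss_sub_le {G₁ G₂ : ℝ≥0} (hq : 1 ≤ q) (hL : ∀ i, LipschitzWith G₁ (L i))
    (hR : LipschitzWith G₂ R) {Q : Finset (Fin n)} (hc : Q.card = q)
    (x y : EuclideanSpace ℝ (Fin d)) :
    subsetLoss L R q Q y - subsetLoss L R q Q x ≤ (G₁ + G₂) * ‖y - x‖ := by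
  have hq' : (0 : ℝ) < q := by exact_mod_cast hq
  have h1 : ∑ i ∈ Q, (L i y - L i x) ≤ q * (G₁ * ‖y - x‖) := by
    rw [← hc, ← nsmul_eq_mul]
    refine Finset.sum_le_card_nsmul _ _ _ fun i _ => ?_
    have := (hL i).dist_le_mul y x
    rw [Real.dist_eq, dist_eq_norm] at this
    exact (le_abs_self _).trans this
  have h2 : R y - R x ≤ G₂ * ‖y - x‖ := by
    have := hR.dist_le_mul y x
    rw [Real.dist_eq, dist_eq_norm] at this
    exact (le_abs_self _).trans this
  have h3 : 1 / (q : ℝ) * ∑ i ∈ Q, (L i y - L i x) ≤ G₁ * ‖y - x‖ := by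
    rw [one_div, inv_mul_le_iff₀ hq']
    exact h1
  rw [Finset.sum_sub_distrib] at h3
  unfold subsetLoss
  linarith

end Losses

/-! ### Subgradients and weak convexity. -/

theorem le_of_forall_le_add_mul {a b c : ℝ} (h : ∀ t : ℝ, 0 < t → t < 1 → a ≤ b + t * c) :
    a ≤ b := by
  have ht : Filter.Tendsto (fun t : ℝ => b + t * c) (nhdsWithin 0 (Set.Ioi 0)) (nhds b) := by
    have : Filter.Tendsto (fun t : ℝ => b + t * c) (nhds 0) (nhds (b + 0 * c)) :=
      (Continuous.tendsto (by fun_prop) 0)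
    rw [zero_mul, add_zero] at this
    exact this.mono_left nhdsWithin_le_nhds
  refine ge_of_tendsto ht ?_
  filter_upwards [Ioo_mem_nhdsGT (zero_lt_one' ℝ)] with t ht
  exact h t ht.1 ht.2

section WeakConvexity

variable {d : ℕ}

/-- Test the subgradient inequality at `x + t • g`: the weak convexity term is of order `t ^ 2` and
vanishes after division by `t`. -/
theorem norm_le_of_mem_subdifferential {ρ K : ℝ} {f : EuclideanSpace ℝ (Fin d) → ℝ}
    {x g : EuclideanSpace ℝ (Fin d)} (hK : 0 ≤ K)
    (hf : ∀ y, f y - f x ≤ K * ‖y - x‖) (hg : g ∈ subdifferential ρ f x) : ‖g‖ ≤ K := by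
  by_cases h0 : g = 0
  · rwa [h0, norm_zero]
  have hpos : 0 < ‖g‖ := norm_pos_iff.2 h0
  have h1 : ‖g‖ * ‖g‖ ≤ K * ‖g‖ := by
    refine le_of_forall_le_add_mul (c := ρ / 2 * ‖g‖ ^ 2) fun t ht _ => ?_
    have h2 := hg (x + t • g)
    have h3 := hf (x + t • g)
    rw [add_sub_cancel_left, norm_smul, Real.norm_of_nonneg ht.le] at h2 h3
    rw [real_inner_smul_right, real_inner_self_eq_norm_sq] at h2
    have : t * (‖g‖ * ‖g‖) ≤ t * (K * ‖g‖ + t * (ρ / 2 * ‖g‖ ^ 2)) := by nlinarith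
    exact le_of_mul_le_mul_left this ht
  exact le_of_mul_le_mul_right h1 hpos

theorem norm_sq_segment (p b x : EuclideanSpace ℝ (Fin d)) (t : ℝ) :
    ‖p + t • (b - p) - x‖ ^ 2 =
      (1 - t) * ‖p - x‖ ^ 2 + t * ‖b - x‖ ^ 2 - t * (1 - t) * ‖b - p‖ ^ 2 := by
  have e1 : p + t • (b - p) - x = (p - x) + t • (b - p) := by abel
  have e2 : b - x = (p - x) + (b - p) := by abel
  rw [e1, e2, norm_add_sq_real, norm_add_sq_real, norm_smul, real_inner_smul_right, mul_pow,
    Real.norm_eq_abs, sq_abs]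
  ring

/-- Weak convexity of modulus `ρ`, as an inequality along segments. -/
def SegmentConvex (ρ : ℝ) (f : EuclideanSpace ℝ (Fin d) → ℝ) : Prop :=
  ∀ p b : EuclideanSpace ℝ (Fin d), ∀ t : ℝ, 0 ≤ t → t ≤ 1 →
    f (p + t • (b - p)) ≤ (1 - t) * f p + t * f b + ρ / 2 * (t * (1 - t) * ‖b - p‖ ^ 2)

theorem WeaklyConvex.segmentConvex {ρ : ℝ} {f : EuclideanSpace ℝ (Fin d) → ℝ}
    (hf : WeaklyConvex ρ f) : SegmentConvex ρ f := by
  intro p b t h0 h1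
  have h := hf.2 (Set.mem_univ p) (Set.mem_univ b) (sub_nonneg.2 h1) h0 (by ring)
  have e : (1 - t) • p + t • b = p + t • (b - p) := by module
  have h2 := norm_sq_segment p b 0 t
  simp only [sub_zero] at h2
  simp only [smul_eq_mul] at h
  rw [e, h2] at h
  linarith

theorem weaklyConvex_zero_of_convexOn {f : EuclideanSpace ℝ (Fin d) → ℝ}
    (hf : ConvexOn ℝ Set.univ f) : WeaklyConvex 0 f := by
  simpa [WeaklyConvex] using hf

theorem SegmentConvex.subsetLoss {n q : ℕ} {L : Fin n → EuclideanSpace ℝ (Fin d) → ℝ}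
    {R : EuclideanSpace ℝ (Fin d) → ℝ} {ρ : ℝ} (hq : 1 ≤ q)
    (hL : ∀ i, SegmentConvex ρ (L i)) (hR : SegmentConvex 0 R) {Q : Finset (Fin n)}
    (hc : Q.card = q) : SegmentConvex ρ (subsetLoss L R q Q) := by
  intro p b t h0 h1
  have hq' : (0 : ℝ) < q := by exact_mod_cast hq
  have hs := Finset.sum_le_sum (s := Q) fun i _ => hL i p b t h0 h1
  rw [Finset.sum_add_distrib, Finset.sum_add_distrib, ← Finset.mul_sum, ← Finset.mul_sum,
    Finset.sum_const, hc, nsmul_eq_mul] at hs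
  have hs' := mul_le_mul_of_nonneg_left hs (one_div_nonneg.2 hq'.le)
  have e : 1 / (q : ℝ) * ((1 - t) * ∑ i ∈ Q, L i p + t * ∑ i ∈ Q, L i b +
      q * (ρ / 2 * (t * (1 - t) * ‖b - p‖ ^ 2))) =
      (1 - t) * (1 / (q : ℝ) * ∑ i ∈ Q, L i p) + t * (1 / (q : ℝ) * ∑ i ∈ Q, L i b) +
      ρ / 2 * (t * (1 - t) * ‖b - p‖ ^ 2) := by
    field_simp
  rw [e] at hs'
  have hr := hR p b t h0 h1
  unfold OrderedSGD.subsetLoss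
  linarith

/-- A set `Q` that is optimal at the intermediate point is still a competitor at both endpoints. -/
theorem SegmentConvex.topLoss {n q : ℕ} {L : Fin n → EuclideanSpace ℝ (Fin d) → ℝ}
    {R : EuclideanSpace ℝ (Fin d) → ℝ} {ρ : ℝ} (hq : 1 ≤ q)
    (hL : ∀ i, SegmentConvex ρ (L i)) (hR : SegmentConvex 0 R) {A : Finset (Fin n)}
    (hA : q ≤ A.card) : SegmentConvex ρ (topLoss L R q A) := by
  intro p b t h0 h1
  obtain ⟨Q, hQ, hc, he⟩ := exists_topLoss_eq (L := L) (R := R) hA (p + t • (b - p))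
  rw [he]
  have hp := mul_le_mul_of_nonneg_left (subsetLoss_le_topLoss (L := L) (R := R) hQ hc p)
    (sub_nonneg.2 h1)
  have hb := mul_le_mul_of_nonneg_left (subsetLoss_le_topLoss (L := L) (R := R) hQ hc b) h0
  have := SegmentConvex.subsetLoss hq hL hR hc p b t h0 h1
  linarith

theorem SegmentConvex.orderedLoss {n s q : ℕ} {L : Fin n → EuclideanSpace ℝ (Fin d) → ℝ}
    {R : EuclideanSpace ℝ (Fin d) → ℝ} {ρ : ℝ} (hq : 1 ≤ q) (hqs : q ≤ s) (hsn : s ≤ n)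
    (hL : ∀ i, SegmentConvex ρ (L i)) (hR : SegmentConvex 0 R) :
    SegmentConvex ρ (orderedLoss L R s q) := by
  intro p b t h0 h1
  have hC : (0 : ℝ) < n.choose s := by exact_mod_cast Nat.choose_pos hsn
  have hs := Finset.sum_le_sum (s := (Finset.univ : Finset (Fin n)).powersetCard s) fun A hA =>
    SegmentConvex.topLoss (A := A) hq hL hR
      ((Finset.mem_powersetCard.1 hA).2.symm ▸ hqs) p b t h0 h1
  rw [Finset.sum_add_distrib, Finset.sum_add_distrib, ← Finset.mul_sum, ← Finset.mul_sum,
    Finset.sum_const, Finset.card_powersetCard, Finset.card_univ, Fintype.card_fin,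
    nsmul_eq_mul] at hs
  simp only [orderedLoss_eq hqs hsn]
  refine (mul_le_mul_of_nonneg_left hs (one_div_nonneg.2 hC.le)).trans_eq ?_
  field_simp

/-! ### Proximal points and the Moreau envelope. -/

/-- `p` minimizes `f + r / 2 * ‖· - x‖ ^ 2`. -/
def IsProx (f : EuclideanSpace ℝ (Fin d) → ℝ) (r : ℝ) (x p : EuclideanSpace ℝ (Fin d)) : Prop :=
  ∀ b, f p + r / 2 * ‖p - x‖ ^ 2 ≤ f b + r / 2 * ‖b - x‖ ^ 2

theorem exists_isProx {f : EuclideanSpace ℝ (Fin d) → ℝ} {r m : ℝ} (hr : 0 < r)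
    (hf : Continuous f) (hm : ∀ b, m ≤ f b) (x : EuclideanSpace ℝ (Fin d)) :
    ∃ p, IsProx f r x p := by
  have hcont : Continuous fun b => f b + r / 2 * ‖b - x‖ ^ 2 := by fun_prop
  refine hcont.exists_forall_le ?_
  have h1 : Filter.Tendsto (fun b : EuclideanSpace ℝ (Fin d) => r / 2 * ‖b - x‖ ^ 2)
      (Filter.cocompact _) Filter.atTop := by
    refine Filter.Tendsto.const_mul_atTop (half_pos hr) ?_
    refine (Filter.tendsto_pow_atTop two_ne_zero).comp ?_
    simpa only [dist_eq_norm] using tendsto_dist_right_cocompact_atTop x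
  exact Filter.tendsto_atTop_add_left_of_le _ m hm h1

/-- The proximal objective is strongly convex with modulus `r - ρ`. Compare `p` with `p + t • (b -
p)`, divide by `t` and let `t → 0`. -/
theorem IsProx.growth {f : EuclideanSpace ℝ (Fin d) → ℝ} {ρ r : ℝ} (hf : SegmentConvex ρ f)
    {x p : EuclideanSpace ℝ (Fin d)} (hp : IsProx f r x p) (b : EuclideanSpace ℝ (Fin d)) :
    f p + r / 2 * ‖p - x‖ ^ 2 + (r - ρ) / 2 * ‖b - p‖ ^ 2 ≤ f b + r / 2 * ‖b - x‖ ^ 2 := by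
  refine le_of_forall_le_add_mul (c := (r - ρ) / 2 * ‖b - p‖ ^ 2) fun t ht ht1 => ?_
  have h1 := hp (p + t • (b - p))
  have h2 := hf p b t ht.le ht1.le
  rw [norm_sq_segment] at h1
  refine le_of_mul_le_mul_left ?_ ht
  linarith

theorem IsProx.moreauEnvelope_isLeast {f : EuclideanSpace ℝ (Fin d) → ℝ} {r : ℝ}
    {x p : EuclideanSpace ℝ (Fin d)} (hp : IsProx f r x p) :
    IsLeast (Set.range fun b => f b + 1 / (2 * (1 / r)) * ‖b - x‖ ^ 2)
      (f p + r / 2 * ‖p - x‖ ^ 2) := by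
  have e : 1 / (2 * (1 / r)) = r / 2 := by
    rw [one_div, mul_inv, one_div, inv_inv, mul_comm, div_eq_mul_inv]
  rw [e]
  refine ⟨⟨p, rfl⟩, ?_⟩
  rintro _ ⟨b, rfl⟩
  exact hp b

theorem IsProx.moreauEnvelope_eq {f : EuclideanSpace ℝ (Fin d) → ℝ} {r : ℝ}
    {x p : EuclideanSpace ℝ (Fin d)} (hp : IsProx f r x p) :
    moreauEnvelope f (1 / r) x = f p + r / 2 * ‖p - x‖ ^ 2 :=
  hp.moreauEnvelope_isLeast.csInf_eq

/-- Add the growth inequalities of the two proximal points, each tested at the other: the values of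
`f` cancel, and Cauchy–Schwarz bounds what remains. -/
theorem IsProx.norm_sub_le {f : EuclideanSpace ℝ (Fin d) → ℝ} {ρ r : ℝ} (hr : 0 < r)
    (hρ : ρ < r) (hf : SegmentConvex ρ f) {x y p p' : EuclideanSpace ℝ (Fin d)}
    (hp : IsProx f r x p) (hp' : IsProx f r y p') : ‖p' - p‖ ≤ r / (r - ρ) * ‖y - x‖ := by
  have h1 := hp.growth hf p'
  have h2 := hp'.growth hf p
  have e1 : ‖p' - x‖ ^ 2 - ‖p' - y‖ ^ 2 + ‖p - y‖ ^ 2 - ‖p - x‖ ^ 2 =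
      2 * inner ℝ (p' - p) (y - x) := by
    have a1 : p' - x = (p' - y) + (y - x) := by abel
    have a2 : p - x = (p - y) + (y - x) := by abel
    have a3 : inner ℝ (p' - p) (y - x) = inner ℝ (p' - y) (y - x) - inner ℝ (p - y) (y - x) := by
      rw [← inner_sub_left, sub_sub_sub_cancel_right]
    rw [a1, a2, a3, norm_add_sq_real, norm_add_sq_real]
    ring
  have h3 : inner ℝ (p' - p) (y - x) ≤ ‖p' - p‖ * ‖y - x‖ := real_inner_le_norm _ _
  rw [norm_sub_rev p p'] at h2
  have h4 : (r - ρ) * ‖p' - p‖ ^ 2 ≤ r * (‖p' - p‖ * ‖y - x‖) := by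
    have := mul_le_mul_of_nonneg_left h3 hr.le
    nlinarith
  have hμ : 0 < r - ρ := sub_pos.2 hρ
  rcases (norm_nonneg (p' - p)).eq_or_lt with h0 | h0
  · rw [← h0]; positivity
  · rw [div_mul_eq_mul_div, le_div_iff₀ hμ]
    refine le_of_mul_le_mul_right ?_ h0
    nlinarith

/-- The old proximal point `p` competes in the problem at `y`, so no convexity is needed. -/
theorem IsProx.moreauEnvelope_add_le {f : EuclideanSpace ℝ (Fin d) → ℝ} {r : ℝ}
    {x y p p' : EuclideanSpace ℝ (Fin d)} (hp : IsProx f r x p) (hp' : IsProx f r y p') :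
    moreauEnvelope f (1 / r) y ≤
      moreauEnvelope f (1 / r) x + r * inner ℝ (x - p) (y - x) + r / 2 * ‖y - x‖ ^ 2 := by
  rw [hp.moreauEnvelope_eq, hp'.moreauEnvelope_eq]
  have h := hp' p
  have e : p - y = -((x - p) + (y - x)) := by abel
  rw [e, norm_neg, norm_add_sq_real, norm_sub_rev x p] at h
  linarith

/-- The quadratic upper bound, used at `x` and with `x`, `y` exchanged, encloses the envelope from
both sides; the Lipschitz proximal map makes the discrepancy quadratic. -/
theorem hasGradientAt_moreauEnvelope {f : EuclideanSpace ℝ (Fin d) → ℝ} {ρ r : ℝ} (hr : 0 < r)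
    (hρ : ρ < r) (hf : SegmentConvex ρ f)
    {prox : EuclideanSpace ℝ (Fin d) → EuclideanSpace ℝ (Fin d)}
    (hprox : ∀ x, IsProx f r x (prox x)) (x : EuclideanSpace ℝ (Fin d)) :
    HasGradientAt (moreauEnvelope f (1 / r)) (r • (x - prox x)) x := by
  rw [hasGradientAt_iff_isLittleO]
  have hO : (fun y => moreauEnvelope f (1 / r) y - moreauEnvelope f (1 / r) x -
      inner ℝ (r • (x - prox x)) (y - x)) =O[nhds x] fun y => ‖y - x‖ ^ 2 := by
    -- The term `r / 2` comes from the quadratic upper bound, the other is `r` times the Lipschitz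
    -- constant of `prox`.
    refine Asymptotics.IsBigO.of_bound (r / 2 + r * (r / (r - ρ))) (Filter.Eventually.of_forall
      fun y => ?_)
    rw [Real.norm_eq_abs, Real.norm_of_nonneg (sq_nonneg _), real_inner_smul_left, abs_le]
    have h1 := (hprox x).moreauEnvelope_add_le (hprox y)
    have h2 := (hprox y).moreauEnvelope_add_le (hprox x)
    have h3 := (hprox x).norm_sub_le hr hρ hf (hprox y)
    have h4 : inner ℝ (prox y - prox x) (y - x) ≤ ‖prox y - prox x‖ * ‖y - x‖ :=
      real_inner_le_norm _ _
    have h5 : inner ℝ (prox y - prox x) (y - x) ≤ r / (r - ρ) * ‖y - x‖ ^ 2 := by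
      refine h4.trans ?_
      rw [pow_two, ← mul_assoc]
      exact mul_le_mul_of_nonneg_right h3 (norm_nonneg _)
    have e : inner ℝ (y - prox y) (x - y) =
        - inner ℝ (x - prox x) (y - x) - ‖y - x‖ ^ 2 +
          inner ℝ (prox y - prox x) (y - x) := by
      have a1 : x - y = -(y - x) := by abel
      have a2 : y - prox y = (x - prox x) + (y - x) - (prox y - prox x) := by abel
      rw [a1, a2, inner_neg_right, inner_sub_left, inner_add_left, real_inner_self_eq_norm_sq]
      ring
    rw [e, norm_sub_rev x y] at h2
    have h6 := mul_le_mul_of_nonneg_left h5 hr.le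
    have h7 : 0 ≤ r * (r / (r - ρ)) * ‖y - x‖ ^ 2 := by
      have := sub_pos.2 hρ
      positivity
    have h8 : 0 ≤ r * ‖y - x‖ ^ 2 := by positivity
    constructor <;> linarith
  exact hO.trans_isLittleO (Asymptotics.isLittleO_pow_sub_sub x one_lt_two)

theorem continuous_prox {f : EuclideanSpace ℝ (Fin d) → ℝ} {ρ r : ℝ} (hr : 0 < r)
    (hρ : ρ < r) (hf : SegmentConvex ρ f)
    {prox : EuclideanSpace ℝ (Fin d) → EuclideanSpace ℝ (Fin d)}
    (hprox : ∀ x, IsProx f r x (prox x)) : Continuous prox := by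
  have hK : 0 ≤ r / (r - ρ) := div_nonneg hr.le (sub_pos.2 hρ).le
  refine (LipschitzWith.of_dist_le_mul (K := ⟨r / (r - ρ), hK⟩) fun y x => ?_).continuous
  rw [dist_eq_norm, dist_eq_norm]
  exact (hprox x).norm_sub_le hr hρ hf (hprox y)

end WeakConvexity

/-! ### Expectations along a run of the algorithm. -/

/-- Disintegration along a finite-valued random index that is independent of `Y`. -/
theorem integral_apply_of_indep {Ω κ 𝓧 : Type*} [Fintype κ] {m mΩ : MeasurableSpace Ω}
    [m𝓧 : MeasurableSpace 𝓧] {P : Measure Ω} (hm : m ≤ mΩ) {τ : Ω → κ} {Y : Ω → 𝓧}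
    (hτ : ∀ k, MeasurableSet[m] {ω | τ ω = k}) (hY : Measurable Y)
    (hind : Indep m (m𝓧.comap Y) P) {F : κ → 𝓧 → ℝ} (hF : ∀ k, Measurable (F k))
    (hint : ∀ k, Integrable (fun ω => F k (Y ω)) P) :
    Integrable (fun ω => F (τ ω) (Y ω)) P ∧
      ∫ ω, F (τ ω) (Y ω) ∂P = ∑ k, P.real {ω | τ ω = k} * ∫ ω, F k (Y ω) ∂P := by
  classical
  have e : (fun ω => F (τ ω) (Y ω)) =
      fun ω => ∑ k, Set.indicator {ω | τ ω = k} (fun ω => F k (Y ω)) ω := by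
    ext ω
    simp [Set.indicator_apply]
  have hi : ∀ k, Integrable (Set.indicator {ω | τ ω = k} (fun ω => F k (Y ω))) P :=
    fun k => (hint k).indicator (hm _ (hτ k))
  rw [e]
  refine ⟨integrable_finsetSum _ fun k _ => hi k, ?_⟩
  rw [integral_finsetSum _ fun k _ => hi k]
  refine Finset.sum_congr rfl fun k _ => ?_
  rw [integral_indicator (hm _ (hτ k))]
  exact hind.setIntegral_eq_mul hm hY.aemeasurable (hτ k) (hF k).aestronglyMeasurable

namespace IsOrderedSGD

variable {n d s q : ℕ} {Ω : Type*} [mΩ : MeasurableSpace Ω] {P : Measure Ω}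
  {ℱ : Filtration ℕ mΩ} {ρ : ℝ}
  {L : Fin n → EuclideanSpace ℝ (Fin d) → ℝ} {R : EuclideanSpace ℝ (Fin d) → ℝ}
  {G₁ G₂ : ℝ≥0} {η : ℕ → ℝ} {θ₀ : EuclideanSpace ℝ (Fin d)} {S Q : ℕ → Ω → Finset (Fin n)}
  {g θ : ℕ → Ω → EuclideanSpace ℝ (Fin d)}

theorem adapted (h : IsOrderedSGD P ℱ ρ L R s q η θ₀ S Q g θ) (t : ℕ) :
    Measurable[ℱ t] (θ t) := by
  induction t with
  | zero =>
    rw [show θ 0 = fun _ => θ₀ from funext h.init]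
    exact measurable_const
  | succ t ih =>
    rw [show θ (t + 1) = fun ω => θ t ω - η t • g t ω from funext (h.update t)]
    exact (ih.mono (ℱ.mono t.le_succ) le_rfl).sub ((h.measurable_subgradient t).const_smul (η t))

theorem measurable_iterate (h : IsOrderedSGD P ℱ ρ L R s q η θ₀ S Q g θ) (t : ℕ) :
    Measurable (θ t) :=
  (h.adapted t).mono (ℱ.le t) le_rfl

theorem norm_subgradient_le (h : IsOrderedSGD P ℱ ρ L R s q η θ₀ S Q g θ) (hq : 1 ≤ q)
    (hL : ∀ i, LipschitzWith G₁ (L i)) (hR : LipschitzWith G₂ R) (t : ℕ) (ω : Ω) :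
    ‖g t ω‖ ≤ G₁ + G₂ :=
  norm_le_of_mem_subdifferential (by positivity)
    (fun y => subsetLoss_sub_le hq hL hR (h.top t ω).2.1 (θ t ω) y) (h.subgradient t ω)

/-- A bound uniform in `ω` makes every continuous function of an iterate integrable. -/
theorem exists_norm_iterate_le (h : IsOrderedSGD P ℱ ρ L R s q η θ₀ S Q g θ) (hq : 1 ≤ q)
    (hL : ∀ i, LipschitzWith G₁ (L i)) (hR : LipschitzWith G₂ R) (t : ℕ) :
    ∃ B : ℝ, ∀ ω, ‖θ t ω‖ ≤ B := by
  induction t with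
  | zero => exact ⟨‖θ₀‖, fun ω => by rw [h.init]⟩
  | succ t ih =>
    obtain ⟨B, hB⟩ := ih
    refine ⟨B + |η t| * (G₁ + G₂), fun ω => ?_⟩
    rw [h.update]
    refine (norm_sub_le _ _).trans (add_le_add (hB ω) ?_)
    rw [norm_smul, Real.norm_eq_abs]
    exact mul_le_mul_of_nonneg_left (h.norm_subgradient_le hq hL hR t ω) (abs_nonneg _)

variable [IsProbabilityMeasure P]

theorem integrable_comp (h : IsOrderedSGD P ℱ ρ L R s q η θ₀ S Q g θ) (hq : 1 ≤ q)
    (hL : ∀ i, LipschitzWith G₁ (L i)) (hR : LipschitzWith G₂ R) (t : ℕ)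
    {F : EuclideanSpace ℝ (Fin d) → ℝ} (hF : Continuous F) :
    Integrable (fun ω => F (θ t ω)) P := by
  obtain ⟨B, hB⟩ := h.exists_norm_iterate_le hq hL hR t
  obtain ⟨C, hC⟩ := (isCompact_closedBall (0 : EuclideanSpace ℝ (Fin d)) B).exists_bound_of_continuousOn
    hF.continuousOn
  refine Integrable.of_bound (hF.measurable.comp (h.measurable_iterate t)).aestronglyMeasurable C
    (Filter.Eventually.of_forall fun ω => hC _ ?_)
  rw [mem_closedBall_zero_iff]
  exact hB ω

/-- Averaging over the mini-batch. -/
theorem integral_batch (h : IsOrderedSGD P ℱ ρ L R s q η θ₀ S Q g θ) (hq : 1 ≤ q)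
    (hL : ∀ i, LipschitzWith G₁ (L i)) (hR : LipschitzWith G₂ R) (t : ℕ)
    {Φ : Finset (Fin n) → EuclideanSpace ℝ (Fin d) → ℝ} (hΦ : ∀ A, Continuous (Φ A)) :
    Integrable (fun ω => Φ (S t ω) (θ t ω)) P ∧
      ∫ ω, Φ (S t ω) (θ t ω) ∂P =
        ∫ ω, 1 / (n.choose s : ℝ) * ∑ A ∈ Finset.univ.powersetCard s, Φ A (θ t ω) ∂P := by
  have hle : MeasurableSpace.comap (S t) ⊤ ≤ mΩ := by
    rintro _ ⟨U, hU, rfl⟩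
    exact ℱ.le (t + 1) _ (h.measurable_batch t hU)
  have hint : ∀ A, Integrable (fun ω => Φ A (θ t ω)) P :=
    fun A => h.integrable_comp hq hL hR t (hΦ A)
  obtain ⟨h1, h2⟩ := integral_apply_of_indep (P := P) (τ := S t) (Y := θ t) hle
    (fun A => ⟨{A}, trivial, rfl⟩) (h.measurable_iterate t)
    (indep_of_indep_of_le_right (h.indep_batch t) (h.adapted t).comap_le)
    (fun A => (hΦ A).measurable) hint
  refine ⟨h1, ?_⟩
  rw [h2, integral_const_mul, integral_finsetSum _ fun A _ => hint A, Finset.mul_sum]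
  symm
  refine Finset.sum_subset_zero_on_sdiff (Finset.subset_univ _) ?_ ?_
  · intro A hA
    have hc : A.card ≠ s := fun hc => (Finset.mem_sdiff.1 hA).2
      (Finset.mem_powersetCard.2 ⟨Finset.subset_univ _, hc⟩)
    have : {ω | S t ω = A} = ∅ := by
      ext ω
      simp only [Set.mem_ofPred_eq, Set.mem_empty_iff_false, iff_false]
      rintro rfl
      exact hc (h.card_batch t ω)
    rw [this, measureReal_empty, zero_mul]
  · intro A hA
    rw [h.uniform_batch t A (Finset.mem_powersetCard.1 hA).2]

/-- One step of both settings: `hV` is what the potential must satisfy along a step, and the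
subgradient inequality at `y x` turns its linear term into a decrease. -/
theorem integral_descent (h : IsOrderedSGD P ℱ ρ L R s q η θ₀ S Q g θ) (hq : 1 ≤ q)
    (hqs : q ≤ s) (hsn : s ≤ n) (hL : ∀ i, LipschitzWith G₁ (L i)) (hR : LipschitzWith G₂ R)
    {V : EuclideanSpace ℝ (Fin d) → ℝ} {y : EuclideanSpace ℝ (Fin d) → EuclideanSpace ℝ (Fin d)}
    {c : ℝ} (hc : 0 ≤ c) (hVc : Continuous V) (hy : Continuous y)
    (hV : ∀ (x v : EuclideanSpace ℝ (Fin d)) (a : ℝ), V (x - a • v) ≤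
      V x + c * a * inner ℝ v (y x - x) + c / 2 * a ^ 2 * ‖v‖ ^ 2) (t : ℕ) (hη : 0 ≤ η t) :
    c * (η t * ∫ ω, (orderedLoss L R s q (θ t ω) - orderedLoss L R s q (y (θ t ω)) -
        ρ / 2 * ‖y (θ t ω) - θ t ω‖ ^ 2) ∂P) ≤
      ∫ ω, V (θ t ω) ∂P - ∫ ω, V (θ (t + 1) ω) ∂P + c * ((G₁ : ℝ) ^ 2 + (G₂ : ℝ) ^ 2) * η t ^ 2 := by
  have hcT : ∀ A, Continuous (topLoss L R q A) :=
    fun A => continuous_topLoss (fun i => (hL i).continuous) hR.continuous A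
  set D : EuclideanSpace ℝ (Fin d) → ℝ := fun x => orderedLoss L R s q x -
    orderedLoss L R s q (y x) - ρ / 2 * ‖y x - x‖ ^ 2 with hD
  -- `Φ` involves only the mini-batch and the current iterate, so independence applies although `Q
  -- t` and `g t` may use further randomness.
  let Φ : Finset (Fin n) → EuclideanSpace ℝ (Fin d) → ℝ := fun A x =>
    topLoss L R q A x - topLoss L R q A (y x) - ρ / 2 * ‖y x - x‖ ^ 2
  obtain ⟨hi, hbatch⟩ := h.integral_batch hq hL hR t (Φ := Φ) (fun A => by
    have := hcT A
    fun_prop)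
  have hC : (n.choose s : ℝ) ≠ 0 := by exact_mod_cast (Nat.choose_pos hsn).ne'
  have hmean : ∀ x, 1 / (n.choose s : ℝ) * ∑ A ∈ Finset.univ.powersetCard s, Φ A x = D x := by
    intro x
    simp only [hD, Φ, orderedLoss_eq hqs hsn, Finset.sum_sub_distrib, Finset.sum_const,
      Finset.card_powersetCard, Finset.card_univ, Fintype.card_fin, nsmul_eq_mul]
    field_simp
  simp only [hmean] at hbatch
  have hVt := h.integrable_comp hq hL hR t hVc
  have hVt' := h.integrable_comp hq hL hR (t + 1) hVc
  have hpt : ∀ ω, V (θ (t + 1) ω) ≤ V (θ t ω) - c * η t * Φ (S t ω) (θ t ω) +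
      c * ((G₁ : ℝ) ^ 2 + (G₂ : ℝ) ^ 2) * η t ^ 2 := by
    intro ω
    have h1 := hV (θ t ω) (g t ω) (η t)
    rw [← h.update] at h1
    have h2 := h.subgradient t ω (y (θ t ω))
    rw [← topLoss_eq_of_mem_qArgmax (h.top t ω)] at h2
    have h3 := h2.trans (subsetLoss_le_topLoss (h.top t ω).1 (h.top t ω).2.1 _)
    have h4 : inner ℝ (g t ω) (y (θ t ω) - θ t ω) ≤ - Φ (S t ω) (θ t ω) := by
      simp only [Φ]
      linarith
    have h5 := mul_le_mul_of_nonneg_left h4 (mul_nonneg hc hη)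
    -- This is `(G₁ + G₂)² ≤ 2 (G₁² + G₂²)`; the 2 cancels the one in `c / 2`.
    have h6 : ‖g t ω‖ ^ 2 ≤ 2 * ((G₁ : ℝ) ^ 2 + (G₂ : ℝ) ^ 2) := by
      have := pow_le_pow_left₀ (norm_nonneg _) (h.norm_subgradient_le hq hL hR t ω) 2
      nlinarith [sq_nonneg ((G₁ : ℝ) - G₂)]
    have h7 := mul_le_mul_of_nonneg_left h6 (by positivity : 0 ≤ c / 2 * η t ^ 2)
    linarith
  have hdiff : Integrable (fun ω => V (θ t ω) - c * η t * Φ (S t ω) (θ t ω)) P :=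
    hVt.sub (hi.const_mul (c * η t))
  have hmono := integral_mono hVt' (hdiff.add (integrable_const (c * ((G₁ : ℝ) ^ 2 + (G₂ : ℝ) ^ 2) * η t ^ 2))) hpt
  simp only [Pi.add_apply] at hmono
  rw [integral_add hdiff (integrable_const _),
    integral_sub hVt (hi.const_mul (c * η t)), integral_const_mul, integral_const, hbatch,
    probReal_univ, one_smul] at hmono
  linarith

theorem sum_integral_descent (h : IsOrderedSGD P ℱ ρ L R s q η θ₀ S Q g θ) (hq : 1 ≤ q)
    (hqs : q ≤ s) (hsn : s ≤ n) (hL : ∀ i, LipschitzWith G₁ (L i)) (hR : LipschitzWith G₂ R)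
    {V : EuclideanSpace ℝ (Fin d) → ℝ} {y : EuclideanSpace ℝ (Fin d) → EuclideanSpace ℝ (Fin d)}
    {c m : ℝ} (hc : 0 ≤ c) (hVc : Continuous V) (hy : Continuous y)
    (hV : ∀ (x v : EuclideanSpace ℝ (Fin d)) (a : ℝ), V (x - a • v) ≤
      V x + c * a * inner ℝ v (y x - x) + c / 2 * a ^ 2 * ‖v‖ ^ 2) (hm : ∀ x, m ≤ V x)
    (N : ℕ) (hη : ∀ t < N, 0 ≤ η t) :
    c * ∑ t ∈ Finset.range N, η t *
        ∫ ω, (orderedLoss L R s q (θ t ω) - orderedLoss L R s q (y (θ t ω)) -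
          ρ / 2 * ‖y (θ t ω) - θ t ω‖ ^ 2) ∂P ≤
      V θ₀ - m + c * ((G₁ : ℝ) ^ 2 + (G₂ : ℝ) ^ 2) * ∑ t ∈ Finset.range N, η t ^ 2 := by
  have hsum := Finset.sum_le_sum fun t (ht : t ∈ Finset.range N) =>
    h.integral_descent hq hqs hsn hL hR hc hVc hy hV t (hη t (Finset.mem_range.1 ht))
  rw [← Finset.mul_sum, Finset.sum_add_distrib, ← Finset.mul_sum,
    Finset.sum_range_sub' (fun t => ∫ ω, V (θ t ω) ∂P)] at hsum
  have h0 : ∫ ω, V (θ 0 ω) ∂P = V θ₀ := by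
    simp only [h.init, integral_const, probReal_univ, one_smul]
  have hN : m ≤ ∫ ω, V (θ N ω) ∂P := by
    have := integral_mono (integrable_const m) (h.integrable_comp hq hL hR N hVc)
      (fun ω => hm (θ N ω))
    simpa using this
  linarith

end IsOrderedSGD

end OrderedSGD

end

/-! ### The two convergence rates. -/

theorem theorem2 {n d s q : ℕ} (hq : 1 ≤ q) (hqs : q ≤ s) (hsn : s ≤ n)
    (L : Fin n → EuclideanSpace ℝ (Fin d) → ℝ) (R : EuclideanSpace ℝ (Fin d) → ℝ)
    (G₁ G₂ : ℝ≥0) (hL : ∀ i, LipschitzWith G₁ (L i)) (hR : LipschitzWith G₂ R)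
    (θstar : EuclideanSpace ℝ (Fin d))
    (hstar : ∀ x, OrderedSGD.orderedLoss L R s q θstar ≤ OrderedSGD.orderedLoss L R s q x)
    (T : ℕ) (η : ℕ → ℝ) (hη : ∀ t ≤ T, 0 ≤ η t)
    (hηsum : 0 < ∑ t ∈ Finset.range (T + 1), η t)
    {Ω : Type*} [mΩ : MeasurableSpace Ω] (P : Measure Ω) [IsProbabilityMeasure P]
    (ℱ : Filtration ℕ mΩ) (θ₀ : EuclideanSpace ℝ (Fin d))
    (S Q : ℕ → Ω → Finset (Fin n)) (g θ : ℕ → Ω → EuclideanSpace ℝ (Fin d)) :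
    -- (1) convex setting
    ((∀ i, ConvexOn ℝ Set.univ (L i)) → ConvexOn ℝ Set.univ R →
      OrderedSGD.IsOrderedSGD P ℱ 0 L R s q η θ₀ S Q g θ →
        (∀ t ≤ T, Integrable (fun ω => OrderedSGD.orderedLoss L R s q (θ t ω)) P) ∧
        (Finset.range (T + 1)).inf' Finset.nonempty_range_add_one
            (fun t => ∫ ω, (OrderedSGD.orderedLoss L R s q (θ t ω) -
              OrderedSGD.orderedLoss L R s q θstar) ∂P) ≤
          (2 * ((G₁ : ℝ) ^ 2 + (G₂ : ℝ) ^ 2) * ∑ t ∈ Finset.range (T + 1), η t ^ 2 +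
              ‖θstar - θ₀‖ ^ 2) /
            (2 * ∑ t ∈ Finset.range (T + 1), η t)) ∧
    -- (2) weakly convex setting; `τ` is the random index of the sampled iterate
    (∀ ρ : ℝ, 0 ≤ ρ → (∀ i, OrderedSGD.WeaklyConvex ρ (L i)) → ConvexOn ℝ Set.univ R →
      OrderedSGD.IsOrderedSGD P ℱ ρ L R s q η θ₀ S Q g θ →
      ∀ τ : Ω → Fin (T + 1), Measurable τ →
        (∀ t : Fin (T + 1),
          P.real {ω | τ ω = t} = η t / ∑ k ∈ Finset.range (T + 1), η k) →
        IndepFun τ (fun ω (t : Fin (T + 1)) => θ t ω) P →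
        ∀ ρhat : ℝ, ρ < ρhat →
          (∀ x, IsLeast
            (Set.range fun β =>
              OrderedSGD.orderedLoss L R s q β + 1 / (2 * (1 / ρhat)) * ‖β - x‖ ^ 2)
            (OrderedSGD.moreauEnvelope (OrderedSGD.orderedLoss L R s q) (1 / ρhat) x)) ∧
          Differentiable ℝ
            (OrderedSGD.moreauEnvelope (OrderedSGD.orderedLoss L R s q) (1 / ρhat)) ∧
          Integrable (fun ω => ‖gradient (OrderedSGD.moreauEnvelope
            (OrderedSGD.orderedLoss L R s q) (1 / ρhat)) (θ (τ ω) ω)‖ ^ 2) P ∧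
          ∫ ω, ‖gradient (OrderedSGD.moreauEnvelope
              (OrderedSGD.orderedLoss L R s q) (1 / ρhat)) (θ (τ ω) ω)‖ ^ 2 ∂P ≤
            ρhat / (ρhat - ρ) *
              (((OrderedSGD.moreauEnvelope (OrderedSGD.orderedLoss L R s q) (1 / ρhat) θ₀ -
                    OrderedSGD.orderedLoss L R s q θstar) +
                  ρhat * ((G₁ : ℝ) ^ 2 + (G₂ : ℝ) ^ 2) *
                    ∑ t ∈ Finset.range (T + 1), η t ^ 2) /
                ∑ t ∈ Finset.range (T + 1), η t)) := by
  have hLc := fun i => (hL i).continuous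
  have hfc := OrderedSGD.continuous_orderedLoss hqs hsn hLc hR.continuous
  refine ⟨fun hLconv hRconv h => ⟨fun t _ => h.integrable_comp hq hL hR t hfc, ?_⟩, ?_⟩
  -- Expanding the square gives `hV` with equality for `c = 2`.
  · have hsum := h.sum_integral_descent hq hqs hsn hL hR (V := fun x => ‖x - θstar‖ ^ 2)
      (y := fun _ => θstar) (c := 2) (m := 0) zero_le_two (by fun_prop) continuous_const
      (fun x v a => by
        have e : x - a • v - θstar = -((θstar - x) + a • v) := by abel
        rw [e, norm_neg, norm_add_sq_real, norm_smul, real_inner_smul_right, real_inner_comm v,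
          norm_sub_rev x, mul_pow, Real.norm_eq_abs, sq_abs]
        linarith)
      (fun x => sq_nonneg _) (T + 1) (fun t ht => hη t (Nat.lt_succ_iff.1 ht))
    simp only [zero_div, zero_mul, sub_zero] at hsum
    rw [le_div_iff₀ (mul_pos two_pos hηsum), norm_sub_rev θstar]
    refine le_trans ?_ (hsum.trans_eq (add_comm _ _))
    rw [mul_left_comm, Finset.mul_sum]
    refine mul_le_mul_of_nonneg_left (Finset.sum_le_sum fun t ht => ?_) zero_le_two
    rw [mul_comm]
    exact mul_le_mul_of_nonneg_left (Finset.inf'_le _ ht)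
      (hη t (Nat.lt_succ_iff.1 (Finset.mem_range.1 ht)))
  · intro ρ hρ hLw hRconv h τ hτ hτP hτind r hr
    have hr0 : 0 < r := hρ.trans_lt hr
    have hseg : OrderedSGD.SegmentConvex ρ (OrderedSGD.orderedLoss L R s q) :=
      OrderedSGD.SegmentConvex.orderedLoss hq hqs hsn (fun i => (hLw i).segmentConvex)
        (OrderedSGD.weaklyConvex_zero_of_convexOn hRconv).segmentConvex
    choose prox hprox using OrderedSGD.exists_isProx hr0 hfc hstar
    have hgrad := OrderedSGD.hasGradientAt_moreauEnvelope hr0 hr hseg hprox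
    have hproxc := OrderedSGD.continuous_prox hr0 hr hseg hprox
    have hdiff : Differentiable ℝ
        (OrderedSGD.moreauEnvelope (OrderedSGD.orderedLoss L R s q) (1 / r)) :=
      fun x => (hgrad x).differentiableAt
    simp only [fun x => (hgrad x).gradient]
    have hgc : Continuous fun x => ‖r • (x - prox x)‖ ^ 2 := by fun_prop
    -- With `Y` the whole vector of iterates and `F k` reading its coordinate `k`, the sampled
    -- iterate becomes an `η`-weighted mean.
    obtain ⟨hint, heq⟩ := OrderedSGD.integral_apply_of_indep (P := P) hτ.comap_le (τ := τ)
      (Y := fun ω (t : Fin (T + 1)) => θ t ω) (fun k => ⟨{k}, measurableSet_singleton k, rfl⟩)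
      (measurable_pi_lambda _ fun t => h.measurable_iterate t) hτind
      (F := fun k Y => ‖r • (Y k - prox (Y k))‖ ^ 2)
      (fun k => hgc.measurable.comp (measurable_pi_apply k))
      (fun k => h.integrable_comp hq hL hR k hgc)
    refine ⟨fun x => ?_, hdiff, hint, ?_⟩
    · rw [(hprox x).moreauEnvelope_eq]
      exact (hprox x).moreauEnvelope_isLeast
    have hsum := h.sum_integral_descent hq hqs hsn hL hR
      (V := OrderedSGD.moreauEnvelope (OrderedSGD.orderedLoss L R s q) (1 / r))
      (y := prox) (c := r) (m := OrderedSGD.orderedLoss L R s q θstar) hr0.le hdiff.continuous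
      hproxc (fun x v a => by
        have := (hprox x).moreauEnvelope_add_le (hprox (x - a • v))
        have e : x - a • v - x = -(a • v) := by abel
        rw [e, norm_neg, norm_smul, mul_pow, Real.norm_eq_abs, sq_abs, inner_neg_right,
          real_inner_smul_right, real_inner_comm] at this
        rw [← neg_sub x (prox x), inner_neg_right]
        linarith)
      (fun x => by
        rw [(hprox x).moreauEnvelope_eq]
        have := hstar (prox x)
        have : 0 ≤ r / 2 * ‖prox x - x‖ ^ 2 := by positivity
        linarith)
      (T + 1) (fun t ht => hη t (Nat.lt_succ_iff.1 ht))
    -- Growth at `b = x` gives `r / 2 + (r - ρ) / 2`; subtracting `ρ / 2` leaves `r - ρ`, and `r ^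
    -- 2` comes from the scaling of the gradient.
    have hlow : ∀ t, (r - ρ) / r ^ 2 * ∫ ω, ‖r • (θ t ω - prox (θ t ω))‖ ^ 2 ∂P ≤
        ∫ ω, (OrderedSGD.orderedLoss L R s q (θ t ω) -
          OrderedSGD.orderedLoss L R s q (prox (θ t ω)) -
          ρ / 2 * ‖prox (θ t ω) - θ t ω‖ ^ 2) ∂P := by
      intro t
      rw [← integral_const_mul]
      refine integral_mono ((h.integrable_comp hq hL hR t hgc).const_mul _)
        (h.integrable_comp hq hL hR t (F := fun x => OrderedSGD.orderedLoss L R s q x -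
          OrderedSGD.orderedLoss L R s q (prox x) - ρ / 2 * ‖prox x - x‖ ^ 2)
          (by fun_prop)) fun ω => ?_
      have h1 := (hprox (θ t ω)).growth hseg (θ t ω)
      rw [sub_self, norm_zero, norm_sub_rev (prox _)] at h1
      have e : (r - ρ) / r ^ 2 * ‖r • (θ t ω - prox (θ t ω))‖ ^ 2 =
          (r - ρ) * ‖θ t ω - prox (θ t ω)‖ ^ 2 := by
        rw [norm_smul, Real.norm_of_nonneg hr0.le]
        field_simp
      simp only [e, norm_sub_rev (prox _)]
      linarith
    have hsum' := (mul_le_mul_of_nonneg_left (Finset.sum_le_sum fun t ht =>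
      mul_le_mul_of_nonneg_left (hlow t)
        (hη t (Nat.lt_succ_iff.1 (Finset.mem_range.1 ht)))) hr0.le).trans hsum
    rw [heq]
    simp only [hτP]
    rw [Fin.sum_univ_eq_sum_range (fun t => (η t / ∑ k ∈ Finset.range (T + 1), η k) *
      ∫ ω, ‖r • (θ t ω - prox (θ t ω))‖ ^ 2 ∂P)]
    have hμ : 0 < r - ρ := sub_pos.2 hr
    have e1 : ∀ t, (η t / ∑ k ∈ Finset.range (T + 1), η k) *
      ∫ ω, ‖r • (θ t ω - prox (θ t ω))‖ ^ 2 ∂P = r / (r - ρ) *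
        (r * (η t * ((r - ρ) / r ^ 2 * ∫ ω, ‖r • (θ t ω - prox (θ t ω))‖ ^ 2 ∂P)) /
          ∑ k ∈ Finset.range (T + 1), η k) := by
      intro t
      field_simp
    simp only [e1]
    rw [← Finset.mul_sum, ← Finset.sum_div, ← Finset.mul_sum]
    exact mul_le_mul_of_nonneg_left (div_le_div_of_nonneg_right hsum' hηsum.le)
      (div_pos hr0 hμ).le
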